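/- Let $V$ be a finite set. For a metric $\mu$ on $V$ let $I(x,y)=\{z\in V:\mu(x,z)+\mu(z,y)=\mu(x,y)\}$, and let $H_\mu$ be the weighted undirected graph on $V$ in which distinct $x,y$ are joined by an edge, of weight $\mu(x,y)$, iff $\mu(x,y)<\mu(x,z)+\mu(z,y)$ for all $z\in V\setminus\{x,y\}$. The metric $\mu$ is modular if $I(x,y)\cap I(y,z)\cap I(x,z)\ne\varnothing$ for all $x,y,z\in V$, and a weighted graph is modular if it equals $H_\mu$ for a modular metric $\mu$. A modular complex $\Gamma$ on $V$ is a modular graph with an orientation $\to$ of its edges such that, for every 4-cycle $x_1,x_2,x_3,x_4$, $x_1\to x_2$ implies $x_4\to x_3$. Write $p\preceq q$ if there is a directed path (possibly of length $0$) from $p$ to $q$ in $\Gamma$, put $[p,q]=\{x: p\preceq x\preceq q\}$, and let $\vee,\wedge$ denote joins (least common upper bounds) and meets (greatest common lower bounds) with respect to $\preceq$, where they exist. A pair $(p,q)$ of vertices is a Boolean pair, written $p\sqsubseteq^{\mathrm{Bp}}q$, if for some $k\ge 0$ the directed graph $\Gamma$ contains as a subgraph a copy of the Hasse diagram of the Boolean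 lattice $\{0,1\}^k$ with source $p$ and sink $q$. A binary relation $\sqsubseteq$ on $V$ is admissible for $\Gamma$ if $p\sqsubseteq q$ implies $p\preceq q$; $p\sqsubseteq p$ for every $p\in V$; $p\sqsubseteq q$ for every edge $p\to q$; and (i) if $p\sqsubseteq q$, $a\preceq b$ and $a,b\in[p,q]$, then $a\sqsubseteq b$; (ii) if $p\sqsubseteq q_1$, $p\sqsubseteq q_2$ and $q_1\vee q_2$ exists, then $p\sqsubseteq q_1\vee q_2$; (iii) if $p_1\sqsubseteq q$, $p_2\sqsubseteq q$ and $p_1\wedge p_2$ exists, then $p_1\wedge p_2\sqsubseteq q$. **Proposition.** Let $\Gamma$ be a modular complex on $V$. Then $\preceq$ is a partial order, and: (a) The relations $\sqsubseteq^{\mathrm{Bp}}$ and $\preceq$ are admissible for $\Gamma$. (b) If $\sqsubseteq$ is admissible for $\Gamma$, then $p\sqsubseteq^{\mathrm{Bp}}q$ implies $p\sqsubseteq q$ for all $p,q\in V$. Consequently, every admissible relation $\sqsubseteq$ satisfies ${\sqsubseteq^{\mathrm{Bp}}}\subseteq{\sqsubseteq}\subseteq{\preceq}$ (as sets of pairs),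 so that $\sqsubseteq^{\mathrm{Bp}}$ and $\preceq$ are the smallest and the largest admissible relations. -/

import Mathlib

/-- A simple undirected graph on `V` with real edge weights. -/
structure WeightedGraph (V : Type*) where
  graph : SimpleGraph V
  weight : graph.edgeSet → ℝ

section Metric

variable (V : Type*) [MetricSpace V]

/-- The graph `H_μ` of a finite metric space `(V, μ)`, that is, the minimal weighted graph whose
path metric is `μ`: two distinct points are joined by an edge iff no third point lies between them,
and an edge is weighted by the distance of its ends. -/
def metricGraph : WeightedGraph V where
  graph :=
    { Adj := fun x y => x ≠ y ∧ ∀ z, z ≠ x → z ≠ y → dist x y < dist x z + dist z y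
      symm := ⟨fun x y h => ⟨h.1.symm, fun z hzy hzx => by
        have := h.2 z hzx hzy
        rw [dist_comm y x, dist_comm y z, dist_comm z x]
        linarith⟩⟩
      loopless := ⟨fun _ h => h.1 rfl⟩ }
  weight := fun e => Sym2.lift ⟨fun x y => dist x y, fun x y => dist_comm x y⟩ e.1

variable {V} in
/-- The metric interval `I(x, y)`. -/
def metricInterval (x y : V) : Set V := {z | dist x z + dist z y = dist x y}

/-- The metric of `V` is modular: all triples of points have a median. -/
def IsModularMetric : Prop :=
  ∀ x y z : V, (metricInterval x y ∩ metricInterval y z ∩ metricInterval x z).Nonempty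

end Metric

/-- A weighted graph is modular if it is the graph `H_μ` of a modular metric `μ`. -/
def WeightedGraph.IsModular {V : Type*} (H : WeightedGraph V) : Prop :=
  ∃ _ : MetricSpace V, IsModularMetric V ∧ H = metricGraph V

/-- An orientation of a simple graph: each edge gets exactly one of its two directions. -/
structure EdgeOrientation {V : Type*} (G : SimpleGraph V) where
  arrow : V → V → Prop
  adj_iff : ∀ x y, G.Adj x y ↔ arrow x y ∨ arrow y x
  asymm : ∀ x y, arrow x y → ¬ arrow y x

/-- An orientation is admissible if opposite edges of every 4-cycle `x₁ x₂ x₃ x₄` are oriented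
in parallel. -/
def EdgeOrientation.IsAdmissible {V : Type*} {G : SimpleGraph V} (o : EdgeOrientation G) : Prop :=
  ∀ x₁ x₂ x₃ x₄ : V, G.Adj x₁ x₂ → G.Adj x₂ x₃ → G.Adj x₃ x₄ → G.Adj x₄ x₁ → x₁ ≠ x₃ → x₂ ≠ x₄ →
    o.arrow x₁ x₂ → o.arrow x₄ x₃

/-- A modular complex (oriented modular graph): a modular graph with an admissible orientation. -/
structure ModularComplex (V : Type*) where
  toWeightedGraph : WeightedGraph V
  isModular : toWeightedGraph.IsModular
  orientation : EdgeOrientation toWeightedGraph.graph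
  isAdmissible : orientation.IsAdmissible

namespace ModularComplex

variable {V : Type*} (Γ : ModularComplex V)

/-- The directed edge relation `p → q`. -/
def Arrow (p q : V) : Prop := Γ.orientation.arrow p q

/-- The relation `p ⪯ q` induced by the directed graph: there is a directed path from `p` to `q`. -/
def Le (p q : V) : Prop := Relation.ReflTransGen Γ.Arrow p q

/-- `j` is the join `p ∨ q`, the lowest common upper bound. -/
def IsJoin (p q j : V) : Prop := Γ.Le p j ∧ Γ.Le q j ∧ ∀ u, Γ.Le p u → Γ.Le q u → Γ.Le j u

/-- `m` is the meet `p ∧ q`, the greatest common lower bound. -/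
def IsMeet (p q m : V) : Prop := Γ.Le m p ∧ Γ.Le m q ∧ ∀ u, Γ.Le u p → Γ.Le u q → Γ.Le u m

/-- The interval `[p, q]`. -/
def interval (p q : V) : Set V := {x | Γ.Le p x ∧ Γ.Le x q}

/-- `(p, q)` is a Boolean pair: for some `k`, the directed graph contains a copy of the Hasse
diagram of the Boolean lattice of rank `k` (here realized as the subsets of a `k`-element set) with
source `p` and sink `q`. -/
def BooleanPair (p q : V) : Prop :=
  ∃ (k : ℕ) (f : Finset (Fin k) → V), Function.Injective f ∧ (∀ A B, A ⋖ B → Γ.Arrow (f A) (f B)) ∧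
    f ∅ = p ∧ f Finset.univ = q

/-- Admissible relations on the vertices of a modular complex. -/
structure IsAdmissibleRel (R : V → V → Prop) : Prop where
  coarsens : ∀ p q, R p q → Γ.Le p q
  refl : ∀ p, R p p
  arrow : ∀ p q, Γ.Arrow p q → R p q
  sub : ∀ p q a b, R p q → Γ.Le a b → a ∈ Γ.interval p q → b ∈ Γ.interval p q → R a b
  join : ∀ p q₁ q₂ j, R p q₁ → R p q₂ → Γ.IsJoin q₁ q₂ j → R p j
  meet : ∀ p₁ p₂ q m, R p₁ q → R p₂ q → Γ.IsMeet p₁ p₂ m → R m q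

end ModularComplex

/-! By the quadrangle condition and parallel opposite edges, directed paths are geodesics
(`dist_add_dist`). So reachability is antisymmetric, its covers are exactly the arrows, and two
arrows out of a vertex with bounded heads close up to a square whose far corner is the join of the
heads; dually for arrows into a vertex.

The rest uses only this local property, `IsLocallyModular`, and finiteness. Bounded pairs have
joins, and joining with an atom climbs at most one step. Hence `(p, q)` is Boolean iff `q` is the
join of the atoms of `[p, q]`, a condition plainly stable under joins and under raising `p`; duality
gives the remaining axioms. Minimality holds because the top of a Boolean cube is reached from its
bottom by joining atoms one at a time. -/

/-! ### Posets whose bounded intervals are modular lattices -/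

/-- A partial order in which two covers of an element that are bounded above have a join covering
both, and dually. -/
class IsLocallyModular (α : Type*) [PartialOrder α] : Prop where
  exists_covBy_isLUB : ∀ a b c u : α, a ⋖ b → a ⋖ c → b ≠ c → b ≤ u → c ≤ u →
    ∃ d, b ⋖ d ∧ c ⋖ d ∧ IsLUB {b, c} d
  exists_covBy_isGLB : ∀ a b c u : α, b ⋖ a → c ⋖ a → b ≠ c → u ≤ b → u ≤ c →
    ∃ d, d ⋖ b ∧ d ⋖ c ∧ IsGLB {b, c} d

/-- `p` and `q` are the bottom and the top of a copy of a finite Boolean lattice whose covering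
relations are covering relations of `α`. -/
def IsBooleanPair {α : Type*} [PartialOrder α] (p q : α) : Prop :=
  ∃ (k : ℕ) (f : Finset (Fin k) → α), Function.Injective f ∧ (∀ A B, A ⋖ B → f A ⋖ f B) ∧
    f ∅ = p ∧ f Finset.univ = q

/-- `q` is the join of the atoms of the interval `[p, q]`. -/
def IsAtomisticPair {α : Type*} [PartialOrder α] (p q : α) : Prop :=
  p ≤ q ∧ ∀ u, p ≤ u → (∀ a, p ⋖ a → a ≤ q → a ≤ u) → q ≤ u

section Order

variable {α : Type*} [PartialOrder α]

theorem isLUB_pair_iff {x y j : α} : IsLUB {x, y} j ↔ ∀ u, j ≤ u ↔ x ≤ u ∧ y ≤ u := by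
  rw [isLUB_iff_le_iff]
  simp [upperBounds]

instance [IsLocallyModular α] : IsLocallyModular αᵒᵈ where
  exists_covBy_isLUB a b c u hb hc hne hbu hcu := by
    obtain ⟨d, h1, h2, h3⟩ := IsLocallyModular.exists_covBy_isGLB (α := α) a b c u
      hb.ofDual hc.ofDual hne hbu hcu
    exact ⟨OrderDual.toDual d, h1.toDual, h2.toDual, h3⟩
  exists_covBy_isGLB a b c u hb hc hne hbu hcu := by
    obtain ⟨d, h1, h2, h3⟩ := IsLocallyModular.exists_covBy_isLUB (α := α) a b c u
      hb.ofDual hc.ofDual hne hbu hcu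
    exact ⟨OrderDual.toDual d, h1.toDual, h2.toDual, h3⟩

/-- Complementation turns the cube upside down. `IsAtomisticPair` is not self-dual by definition, so
duality arguments pass through Boolean pairs. -/
theorem IsBooleanPair.toDual {p q : α} (h : IsBooleanPair p q) :
    IsBooleanPair (OrderDual.toDual q) (OrderDual.toDual p) := by
  obtain ⟨k, f, hf, hcov, rfl, rfl⟩ := h
  refine ⟨k, fun A => OrderDual.toDual (f Aᶜ), fun A B h => ?_, fun A B h => ?_, by simp, by simp⟩
  · exact compl_injective (hf h)
  · refine (hcov _ _ ?_).toDual
    exact ((apply_covBy_apply_iff (OrderIso.compl (Finset (Fin k)))).2 h).ofDual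

theorem IsBooleanPair.ofDual {p q : α}
    (h : IsBooleanPair (OrderDual.toDual q) (OrderDual.toDual p)) : IsBooleanPair p q :=
  h.toDual

theorem IsAtomisticPair.of_isLUB {p q₁ q₂ j : α} (h₁ : IsAtomisticPair p q₁)
    (h₂ : IsAtomisticPair p q₂) (hj : IsLUB {q₁, q₂} j) : IsAtomisticPair p j := by
  have hj₁ : q₁ ≤ j := hj.1 (by simp)
  have hj₂ : q₂ ≤ j := hj.1 (by simp)
  refine ⟨h₁.1.trans hj₁, fun u hpu hu => (isLUB_pair_iff.1 hj u).2 ⟨?_, ?_⟩⟩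
  · exact h₁.2 u hpu fun a ha haq => hu a ha (haq.trans hj₁)
  · exact h₂.2 u hpu fun a ha haq => hu a ha (haq.trans hj₂)

variable [Finite α] [IsLocallyModular α]

/-- Two elements with a common lower bound and a common upper bound have a join. -/
theorem exists_isLUB_pair {p q : α} :
    ∀ x y : α, p ≤ x → p ≤ y → x ≤ q → y ≤ q → ∃ j, IsLUB {x, y} j := by
  induction p using WellFoundedGT.induction with
  | ind p ih =>
    intro x y hpx hpy hxq hyq
    rcases hpx.eq_or_lt with rfl | hpx
    · exact ⟨y, isLUB_pair_iff.2 fun u => ⟨fun h => ⟨hpy.trans h, h⟩, And.right⟩⟩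
    rcases hpy.eq_or_lt with rfl | hpy
    · exact ⟨x, isLUB_pair_iff.2 fun u => ⟨fun h => ⟨h, hpx.le.trans h⟩, And.left⟩⟩
    obtain ⟨x', hpx', hx'⟩ := exists_covBy_le_of_lt hpx
    obtain ⟨y', hpy', hy'⟩ := exists_covBy_le_of_lt hpy
    by_cases hne : x' = y'
    · subst hne
      exact ih x' hpx'.lt x y hx' hy' hxq hyq
    -- With `d = x' ∨ y'`, the join is `(x ∨ d) ∨ y`: the first join is taken above `x'`, the second
    -- above `y'`, so induction gives both.
    obtain ⟨d, hxd, hyd, hd⟩ := IsLocallyModular.exists_covBy_isLUB p x' y' q hpx' hpy' hne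
      (hx'.trans hxq) (hy'.trans hyq)
    rw [isLUB_pair_iff] at hd
    have hdq : d ≤ q := (hd q).2 ⟨hx'.trans hxq, hy'.trans hyq⟩
    obtain ⟨e, he⟩ := ih x' hpx'.lt x d hx' hxd.le hxq hdq
    rw [isLUB_pair_iff] at he
    have hde : d ≤ e := ((he e).1 le_rfl).2
    obtain ⟨j, hj⟩ := ih y' hpy'.lt e y (hyd.le.trans hde) hy' ((he q).2 ⟨hxq, hdq⟩) hyq
    rw [isLUB_pair_iff] at hj
    refine ⟨j, isLUB_pair_iff.2 fun u => ?_⟩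
    rw [hj, he, hd]
    constructor
    · rintro ⟨⟨h, -⟩, h'⟩
      exact ⟨h, h'⟩
    · rintro ⟨h, h'⟩
      exact ⟨⟨h, hx'.trans h, hy'.trans h'⟩, h'⟩

/-- Upper semimodularity: joining with an atom goes up by at most one step. -/
theorem covBy_of_isLUB {a : α} :
    ∀ b x j : α, a ⋖ b → a ≤ x → ¬ b ≤ x → IsLUB {x, b} j → x ⋖ j := by
  induction a using WellFoundedGT.induction with
  | ind a ih =>
    intro b x j hab hax hbx hj
    rw [isLUB_pair_iff] at hj
    rcases hax.eq_or_lt with rfl | hax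
    · have : j = b := le_antisymm ((hj b).2 ⟨hab.le, le_rfl⟩) ((hj j).1 le_rfl).2
      exact this ▸ hab
    obtain ⟨a', haa', ha'x⟩ := exists_covBy_le_of_lt hax
    have hne : a' ≠ b := fun h => hbx (h ▸ ha'x)
    obtain ⟨hxj, hbj⟩ := (hj j).1 le_rfl
    -- Since `d = a' ∨ b` covers `a'` and `x ∨ d = x ∨ b`, the pair `(a', d)` replaces `(a, b)`.
    obtain ⟨d, had, hbd, hd⟩ := IsLocallyModular.exists_covBy_isLUB a a' b j haa' hab hne
      (ha'x.trans hxj) hbj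
    rw [isLUB_pair_iff] at hd
    refine ih a' haa'.lt d x j had ha'x (fun h => hbx (hbd.le.trans h)) (isLUB_pair_iff.2 fun u => ?_)
    rw [hj, hd]
    exact ⟨fun h => ⟨h.1, ha'x.trans h.1, h.2⟩, fun h => ⟨h.1, h.2.2⟩⟩

-- In each square of the cube the top covers both sides and lies above their join, which also covers
-- both; so the two agree. Induction on `A` pastes these squares together.
omit [Finite α] in
theorem isLUB_insert_of_covBy {ι : Type*} [DecidableEq ι] {f : Finset ι → α}
    (hf : Function.Injective f) (hcov : ∀ A B, A ⋖ B → f A ⋖ f B) {i : ι} (A : Finset ι) :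
    i ∉ A → IsLUB {f A, f {i}} (f (insert i A)) := by
  induction A using Finset.induction_on with
  | empty =>
    intro _
    have h : f ∅ ≤ f {i} := (hcov _ _ (Finset.covBy_iff_exists_insert.2 ⟨i, by simp⟩)).le
    rw [isLUB_pair_iff]
    exact fun u => ⟨fun hu => ⟨h.trans hu, hu⟩, And.right⟩
  | insert j B hjB ih =>
    intro hi
    rw [Finset.mem_insert, not_or] at hi
    have hcov' : ∀ {l : ι} {C : Finset ι}, l ∉ C → f C ⋖ f (insert l C) := fun h =>
      hcov _ _ (Finset.covBy_iff_exists_insert.2 ⟨_, h, rfl⟩)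
    have h₁ : f (insert j B) ⋖ f (insert i (insert j B)) := hcov' (by simp [hi])
    have h₂ : f (insert i B) ⋖ f (insert i (insert j B)) := by
      rw [Finset.insert_comm]
      exact hcov' (by simp [hjB, Ne.symm hi.1])
    have hne : f (insert j B) ≠ f (insert i B) := fun h => by
      have : i ∈ insert j B := by
        rw [hf h]
        simp
      simp [hi] at this
    obtain ⟨d, hd₁, -, hd⟩ := IsLocallyModular.exists_covBy_isLUB _ _ _ _ (hcov' hjB) (hcov' hi.2)
      hne h₁.le h₂.le
    rw [isLUB_pair_iff] at hd
    have hdle : d ≤ f (insert i (insert j B)) := (hd _).2 ⟨h₁.le, h₂.le⟩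
    have hdeq : d = f (insert i (insert j B)) := (h₁.eq_or_eq hd₁.le hdle).resolve_left hd₁.ne'
    have ih := isLUB_pair_iff.1 (ih hi.2)
    rw [isLUB_pair_iff, ← hdeq]
    intro u
    rw [hd, ih]
    exact ⟨fun h => ⟨h.1, h.2.2⟩, fun h => ⟨h.1, (hcov' hjB).le.trans h.1, h.2⟩⟩

omit [Finite α] in
/-- The top of a Boolean pair is obtained from covers of the bottom by taking joins. -/
theorem IsBooleanPair.induction {p q : α} (h : IsBooleanPair p q) {P : α → Prop} (hp : P p)
    (hatom : ∀ a, p ⋖ a → P a) (hjoin : ∀ x y j, P x → P y → IsLUB {x, y} j → P j) : P q := by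
  obtain ⟨k, f, hf, hcov, rfl, rfl⟩ := h
  suffices ∀ A, P (f A) from this _
  intro A
  induction A using Finset.induction_on with
  | empty => exact hp
  | insert i A hi ih =>
    exact hjoin _ _ _ ih (hatom _ (hcov _ _ (Finset.covBy_iff_exists_insert.2 ⟨i, by simp⟩)))
      (isLUB_insert_of_covBy hf hcov A hi)

omit [Finite α] in
theorem IsBooleanPair.isAtomisticPair {p q : α} (h : IsBooleanPair p q) :
    IsAtomisticPair p q :=
  h.induction ⟨le_rfl, fun _ hu _ => hu⟩ (fun a ha => ⟨ha.le, fun _ _ hu => hu a ha le_rfl⟩)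
    fun _ _ _ hx hy hj => hx.of_isLUB hy hj

/-- An atom `c` of `[p, q]` is either below `a` or yields an atom `a ∨ c` of `[a, q]`, by
semimodularity. -/
theorem IsAtomisticPair.of_le {p q a : α} (h : IsAtomisticPair p q) (hpa : p ≤ a) (haq : a ≤ q) :
    IsAtomisticPair a q := by
  refine ⟨haq, fun u hau hu => h.2 u (hpa.trans hau) fun c hpc hcq => ?_⟩
  by_cases hca : c ≤ a
  · exact hca.trans hau
  obtain ⟨j, hj⟩ := exists_isLUB_pair a c hpa hpc.le haq hcq
  have hcov := covBy_of_isLUB c a j hpc hpa hca hj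
  rw [isLUB_pair_iff] at hj
  exact ((hj j).1 le_rfl).2.trans (hu j hcov ((hj q).2 ⟨haq, hcq⟩))

/-- A minimal set `S` of atoms with join `q` acts as a basis: sending a subset of `S` to its join
embeds the cube. -/
theorem IsAtomisticPair.isBooleanPair {p q : α} (h : IsAtomisticPair p q) : IsBooleanPair p q := by
  classical
  let T := {a : α // p ⋖ a ∧ a ≤ q}
  have hlub : ∀ A : Finset T, ∃ j, ∀ u, j ≤ u ↔ p ≤ u ∧ ∀ a ∈ A, a.1 ≤ u := by
    intro A
    induction A using Finset.induction_on with
    | empty => exact ⟨p, by simp⟩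
    | insert a A _ ih =>
      obtain ⟨j, hj⟩ := ih
      obtain ⟨j', hj'⟩ := exists_isLUB_pair j a.1 ((hj j).1 le_rfl).1 a.2.1.le
        ((hj q).2 ⟨h.1, fun b _ => b.2.2⟩) a.2.2
      rw [isLUB_pair_iff] at hj'
      refine ⟨j', fun u => ?_⟩
      rw [hj', hj, Finset.forall_mem_insert]
      tauto
  choose F hF using hlub
  have hFp : ∀ A, p ≤ F A := fun A => ((hF A _).1 le_rfl).1
  have hFmem : ∀ {A} {a : T}, a ∈ A → a.1 ≤ F A := fun {A a} ha => ((hF A _).1 le_rfl).2 a ha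
  have hFmono : Monotone F := fun A B hAB => (hF A _).2 ⟨hFp B, fun a ha => hFmem (hAB ha)⟩
  have hFq : ∀ A, F A ≤ q := fun A => (hF A q).2 ⟨h.1, fun b _ => b.2.2⟩
  have : Fintype T := Fintype.ofFinite T
  obtain ⟨S, hS⟩ := exists_minimal_of_wellFoundedLT (fun S : Finset T => q ≤ F S)
    ⟨Finset.univ, h.2 _ (hFp _) fun a ha haq => hFmem (a := ⟨a, ha, haq⟩) (Finset.mem_univ _)⟩
  -- Independence: an atom of `S` below the join of others could be erased, against minimality.
  have hindep : ∀ {i : T} {A : Finset T}, i ∈ S → A ⊆ S → i ∉ A → ¬ i.1 ≤ F A := by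
    intro i A hi hA hiA hle
    have hle' : i.1 ≤ F (S.erase i) :=
      hle.trans (hFmono fun b hb => Finset.mem_erase.2 ⟨fun h => hiA (h ▸ hb), hA hb⟩)
    have hSle : F S ≤ F (S.erase i) := (hF S _).2 ⟨hFp _, fun b hb => by
      by_cases hbi : b = i
      · exact hbi ▸ hle'
      · exact hFmem (Finset.mem_erase.2 ⟨hbi, hb⟩)⟩
    exact Finset.notMem_erase i S (hS.2 (hS.1.trans hSle) (Finset.erase_subset _ _) hi)
  let e : Fin S.card ↪ T := S.equivFin.symm.toEmbedding.trans (Function.Embedding.subtype _)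
  have heS : ∀ i, e i ∈ S := fun i => (S.equivFin.symm i).2
  have hsub : ∀ A : Finset (Fin S.card), A.map e ⊆ S := fun A b hb => by
    obtain ⟨i, -, rfl⟩ := Finset.mem_map.1 hb
    exact heS i
  have huniv : Finset.univ.map e = S := by
    refine (hsub _).antisymm fun b hb => Finset.mem_map.2 ⟨S.equivFin ⟨b, hb⟩, by simp, ?_⟩
    simp [e]
  have hle : ∀ A B : Finset (Fin S.card), F (A.map e) ≤ F (B.map e) → A ⊆ B := by
    intro A B hAB i hi
    by_contra hiB
    exact hindep (heS i) (hsub B) (by simpa using hiB)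
      ((hFmem (Finset.mem_map_of_mem e hi)).trans hAB)
  refine ⟨S.card, fun A => F (A.map e), fun A B hAB => ?_, fun A B hAB => ?_, ?_, ?_⟩
  · exact (hle A B hAB.le).antisymm (hle B A hAB.ge)
  · obtain ⟨i, hi, rfl⟩ := Finset.covBy_iff_exists_insert.1 hAB
    refine covBy_of_isLUB (e i).1 _ _ (e i).2.1 (hFp _)
      (hindep (heS i) (hsub A) (by simpa using hi)) (isLUB_pair_iff.2 fun u => ?_)
    simp only [Finset.map_insert]
    rw [hF, hF, Finset.forall_mem_insert]
    tauto
  · exact le_antisymm ((hF _ p).2 (by simp)) (hFp _)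
  · simp only [huniv]
    exact (hFq S).antisymm hS.1

theorem IsBooleanPair.of_isLUB {p q₁ q₂ j : α} (h₁ : IsBooleanPair p q₁)
    (h₂ : IsBooleanPair p q₂) (hj : IsLUB {q₁, q₂} j) : IsBooleanPair p j :=
  (h₁.isAtomisticPair.of_isLUB h₂.isAtomisticPair hj).isBooleanPair

theorem IsBooleanPair.of_isGLB {p₁ p₂ q m : α} (h₁ : IsBooleanPair p₁ q)
    (h₂ : IsBooleanPair p₂ q) (hm : IsGLB {p₁, p₂} m) : IsBooleanPair m q :=
  (h₁.toDual.of_isLUB h₂.toDual (j := OrderDual.toDual m) hm).ofDual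

theorem IsBooleanPair.of_le_left {p q a : α} (h : IsBooleanPair p q) (hpa : p ≤ a) (haq : a ≤ q) :
    IsBooleanPair a q :=
  (h.isAtomisticPair.of_le hpa haq).isBooleanPair

theorem IsBooleanPair.of_le {p q a b : α} (h : IsBooleanPair p q) (hpa : p ≤ a) (hab : a ≤ b)
    (hbq : b ≤ q) : IsBooleanPair a b :=
  ((h.of_le_left hpa (hab.trans hbq)).toDual.of_le_left (a := OrderDual.toDual b) hbq hab).ofDual

end Order

/-! ### Modular metrics -/

section Metric

variable {V : Type*} [MetricSpace V]

theorem metricGraph_adj_iff {x y : V} : (metricGraph V).graph.Adj x y ↔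
    x ≠ y ∧ ∀ z, dist x z + dist z y = dist x y → z = x ∨ z = y := by
  refine and_congr_right fun _ => forall_congr' fun z => ⟨fun h hz => ?_, fun h hx hy => ?_⟩
  · by_contra! hne
    exact (h hne.1 hne.2).ne' hz
  · refine lt_of_le_of_ne (dist_triangle x z y) fun hz => ?_
    exact (h hz.symm).elim hx hy

/-- A median of three points with respect to a modular metric. -/
theorem IsModularMetric.exists_median (hV : IsModularMetric V) (x y z : V) :
    ∃ m, dist x m + dist m y = dist x y ∧ dist y m + dist m z = dist y z ∧
      dist x m + dist m z = dist x z := by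
  obtain ⟨m, ⟨h₁, h₂⟩, h₃⟩ := hV x y z
  exact ⟨m, h₁, h₂, h₃⟩

/-- No point is equally far from the ends of an edge: one end lies between it and the other. -/
theorem IsModularMetric.dist_of_adj (hV : IsModularMetric V) {x y : V}
    (h : (metricGraph V).graph.Adj x y) (z : V) :
    dist x z = dist x y + dist y z ∨ dist y z = dist x y + dist x z := by
  obtain ⟨m, h₁, h₂, h₃⟩ := hV.exists_median x y z
  rcases (metricGraph_adj_iff.1 h).2 m h₁ with rfl | rfl
  · right
    rw [← h₂, dist_comm y m]
  · exact Or.inl h₃.symm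

/-- The quadrangle condition. -/
theorem IsModularMetric.quadrangle (hV : IsModularMetric V) {p q p₁ p₂ : V}
    (h₁ : (metricGraph V).graph.Adj p p₁) (h₂ : (metricGraph V).graph.Adj p p₂) (hne : p₁ ≠ p₂)
    (hq₁ : dist p p₁ + dist p₁ q = dist p q) (hq₂ : dist p p₂ + dist p₂ q = dist p q) :
    ∃ r, (metricGraph V).graph.Adj p₁ r ∧ (metricGraph V).graph.Adj p₂ r ∧ p ≠ r ∧
      dist p₁ r + dist r q = dist p₁ q ∧ dist p₂ r + dist r q = dist p₂ q := by
  have key : ∀ {p₁ p₂ r : V}, (metricGraph V).graph.Adj p p₁ → (metricGraph V).graph.Adj p p₂ →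
      dist p₁ p₂ = dist p p₁ + dist p p₂ → dist p r = dist p p₁ + dist p p₂ →
      dist p₁ r = dist p p₂ → dist p₂ r = dist p p₁ →
      (metricGraph V).graph.Adj p₁ r := by
    intro p₁ p₂ r h₁ h₂ hd hpr hr₁ hr₂
    have hpos₁ : 0 < dist p p₁ := dist_pos.2 h₁.ne
    have hpos₂ : 0 < dist p p₂ := dist_pos.2 h₂.ne
    refine metricGraph_adj_iff.2 ⟨fun h => ?_, fun z hz => ?_⟩
    · rw [← h, dist_self] at hr₁
      linarith
    -- `r` is between `p₁` and `p₂`, hence so is every `z` between `p₁` and `r`.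
    have hz₂ : dist p₂ z = dist p p₁ + dist p p₂ - dist p₁ z := by
      have := dist_triangle p₁ z p₂
      have := dist_triangle p₂ r z
      rw [dist_comm z p₂] at *
      rw [dist_comm r z] at *
      linarith
    rcases hV.dist_of_adj h₂ z with h | h
    · right
      have := dist_triangle p p₁ z
      refine dist_le_zero.1 ?_
      linarith
    · left
      have hpz : dist p z + dist z p₁ = dist p p₁ := by
        rw [dist_comm z p₁]
        linarith
      refine ((metricGraph_adj_iff.1 h₁).2 z hpz).resolve_left ?_
      rintro rfl
      rw [dist_comm p₁ z] at hz
      linarith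
  have hd : dist p₁ p₂ = dist p p₁ + dist p p₂ := by
    rcases hV.dist_of_adj h₁ p₂ with h | h
    · refine absurd ((metricGraph_adj_iff.1 h₂).2 p₁ h.symm) ?_
      rintro (h | h)
      · exact h₁.ne h.symm
      · exact hne h
    · exact h
  -- The median is the fourth corner: the distance equations make `p, p₁, r, p₂` a rectangle.
  obtain ⟨r, hr₁, hr₂, hr₃⟩ := hV.exists_median p₁ p₂ q
  have hpos₁ : 0 < dist p p₁ := dist_pos.2 h₁.ne
  have hpos₂ : 0 < dist p p₂ := dist_pos.2 h₂.ne
  rw [dist_comm r p₂] at hr₁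
  have e₁ : dist p₁ r = dist p p₂ := by linarith
  have e₂ : dist p₂ r = dist p p₁ := by linarith
  have hpr : dist p r = dist p p₁ + dist p p₂ := by
    have := dist_triangle p p₁ r
    have := dist_triangle p r q
    linarith
  refine ⟨r, key h₁ h₂ hd hpr e₁ e₂, key h₂ h₁ ?_ ?_ e₂ e₁, ?_, hr₃, hr₂⟩
  · rw [dist_comm]
    linarith
  · linarith
  · rintro rfl
    rw [dist_self] at hpr
    linarith

end Metric

/-! ### Admissible orientations of modular graphs -/

/-- `r` is an orientation of the graph of the modular metric space `V` that is parallel on opposite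
edges of 4-cycles. -/
structure IsModularOrientation {V : Type*} [MetricSpace V] (r : V → V → Prop) : Prop where
  modular : IsModularMetric V
  adj_iff : ∀ x y, (metricGraph V).graph.Adj x y ↔ r x y ∨ r y x
  asymm : ∀ x y, r x y → ¬ r y x
  parallel : ∀ x₁ x₂ x₃ x₄ : V, (metricGraph V).graph.Adj x₁ x₂ → (metricGraph V).graph.Adj x₂ x₃ →
    (metricGraph V).graph.Adj x₃ x₄ → (metricGraph V).graph.Adj x₄ x₁ → x₁ ≠ x₃ → x₂ ≠ x₄ →
    r x₁ x₂ → r x₄ x₃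

namespace IsModularOrientation

open Relation

variable {V : Type*} [MetricSpace V] {r : V → V → Prop} (hr : IsModularOrientation r)

include hr

/-- Reversing all arrows reduces meets to joins. -/
theorem swap : IsModularOrientation (Function.swap r) where
  modular := hr.modular
  adj_iff x y := (hr.adj_iff x y).trans or_comm
  asymm x y := hr.asymm y x
  parallel x₁ x₂ x₃ x₄ h₁₂ h₂₃ h₃₄ h₄₁ h₁₃ h₂₄ h :=
    hr.parallel x₂ x₁ x₄ x₃ h₁₂.symm h₄₁.symm h₃₄.symm h₂₃.symm h₂₄ h₁₃ h

theorem adj {x y : V} (h : r x y) : (metricGraph V).graph.Adj x y :=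
  (hr.adj_iff x y).2 (Or.inl h)

/-- Extending a directed path by an edge at its source increases the distance. -/
theorem dist_eq_add_of_arrow {p q : V} (h : ReflTransGen r p q) :
    ∀ s, r s p → dist s q = dist s p + dist p q := by
  induction h using ReflTransGen.head_induction_on with
  | refl => simp
  | @head p p' hpp' _ ih =>
    intro s hsp
    refine (hr.modular.dist_of_adj (hr.adj hsp) q).resolve_right fun hs => ?_
    have hp := ih p hpp'
    have hne : s ≠ p' := by
      rintro rfl
      exact hr.asymm _ _ hsp hpp'
    rw [dist_comm s p] at hs
    -- If `s` were between `p` and `q`, the quadrangle corner `t` would satisfy `t → p'` by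
    -- parallelism and yet be closer to `q` than `p'`, against the induction hypothesis.
    obtain ⟨t, hst, hp't, hpt, -, ht⟩ := hr.modular.quadrangle (hr.adj hsp).symm (hr.adj hpp') hne
      hs.symm hp.symm
    have htp' : r t p' := hr.parallel s p p' t (hr.adj hsp) (hr.adj hpp') hp't hst.symm hne hpt hsp
    have := ih t htp'
    have := dist_pos.2 hp't.ne
    rw [dist_comm t p'] at *
    linarith

/-- Directed paths are geodesics. -/
theorem dist_add_dist {p x q : V} (hpx : ReflTransGen r p x) (hxq : ReflTransGen r x q) :
    dist p x + dist x q = dist p q := by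
  induction hpx using ReflTransGen.head_induction_on with
  | refl => simp
  | @head p p' hpp' hp'x ih =>
    rw [hr.dist_eq_add_of_arrow (hp'x.trans hxq) p hpp', hr.dist_eq_add_of_arrow hp'x p hpp', ← ih,
      add_assoc]

theorem antisymm {p q : V} (hpq : ReflTransGen r p q) (hqp : ReflTransGen r q p) : p = q := by
  have h := hr.dist_add_dist hpq hqp
  rw [dist_self] at h
  have := dist_nonneg (x := p) (y := q)
  have := dist_nonneg (x := q) (y := p)
  exact dist_le_zero.1 (by linarith)

/-- A neighbour of `p` on a geodesic from `p` to `q`, where `p` precedes `q`, lies in the order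
interval. -/
theorem arrow_of_dist {p q : V} (h : ReflTransGen r p q) :
    ∀ s, (metricGraph V).graph.Adj p s → dist p s + dist s q = dist p q →
      r p s ∧ ReflTransGen r s q := by
  induction h using ReflTransGen.head_induction_on with
  | refl =>
    intro s hs hd
    rw [dist_self] at hd
    have := dist_pos.2 hs.ne
    have := dist_nonneg (x := s) (y := q)
    linarith
  | @head p p' hpp' hp'q ih =>
    intro s hs hd
    by_cases hne : p' = s
    · subst hne
      exact ⟨hpp', hp'q⟩
    -- Induction orients `p' → t`; the square `p, p', t, s` carries this over to `p → s`, and `p →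
    -- p'` to `s → t`.
    obtain ⟨t, hp't, hst, hpt, ht, -⟩ := hr.modular.quadrangle (hr.adj hpp') hs hne
      (hr.dist_eq_add_of_arrow hp'q p hpp').symm hd
    obtain ⟨hp't', htq⟩ := ih t hp't ht
    exact ⟨hr.parallel p' t s p hp't hst.symm hs.symm (hr.adj hpp') hne hpt.symm hp't',
      htq.head (hr.parallel p p' t s (hr.adj hpp') hp't hst.symm hs.symm hpt hne hpp')⟩

/-- The quadrangle condition gives a corner below each common upper bound `v`. Distinct corners `d`,
`d'` would form a 4-cycle `b, d, c, d'` in which `b → d` forces `d' → c`, against `c → d'`; so one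
corner serves every `v`. -/
theorem exists_arrow_join {a b c u : V} (hab : r a b) (hac : r a c) (hne : b ≠ c)
    (hbu : ReflTransGen r b u) (hcu : ReflTransGen r c u) :
    ∃ d, r b d ∧ r c d ∧ ∀ v, ReflTransGen r b v → ReflTransGen r c v → ReflTransGen r d v := by
  have key : ∀ v, ReflTransGen r b v → ReflTransGen r c v →
      ∃ d, a ≠ d ∧ r b d ∧ r c d ∧ ReflTransGen r d v := by
    intro v hbv hcv
    obtain ⟨d, hbd, hcd, had, hd, -⟩ := hr.modular.quadrangle (hr.adj hab) (hr.adj hac) hne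
      (hr.dist_eq_add_of_arrow hbv a hab).symm (hr.dist_eq_add_of_arrow hcv a hac).symm
    obtain ⟨hbd', hdv⟩ := hr.arrow_of_dist hbv d hbd hd
    exact ⟨d, had, hbd', hr.parallel a b d c (hr.adj hab) hbd hcd.symm (hr.adj hac).symm had hne hab,
      hdv⟩
  obtain ⟨d, -, hbd, hcd, -⟩ := key u hbu hcu
  refine ⟨d, hbd, hcd, fun v hbv hcv => ?_⟩
  obtain ⟨d', -, hbd', hcd', hdv⟩ := key v hbv hcv
  by_cases hdd : d = d'
  · exact hdd ▸ hdv
  · exact absurd (hr.parallel b d c d' (hr.adj hbd) (hr.adj hcd).symm (hr.adj hcd')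
      (hr.adj hbd').symm hne hdd hbd) (hr.asymm _ _ hcd')

end IsModularOrientation

/-! ### Admissible relations on a modular complex -/

namespace ModularComplex

variable {V : Type*} (Γ : ModularComplex V)

theorem exists_isModularOrientation :
    ∃ _ : MetricSpace V, IsModularOrientation Γ.Arrow := by
  obtain ⟨m, hm, h⟩ := Γ.isModular
  have hadj : ∀ x y, Γ.toWeightedGraph.graph.Adj x y ↔ (metricGraph V).graph.Adj x y := by
    rw [h]
    exact fun _ _ => Iff.rfl
  refine ⟨m, hm, fun x y => (hadj x y).symm.trans (Γ.orientation.adj_iff x y),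
    Γ.orientation.asymm, ?_⟩
  simp only [← hadj]
  exact Γ.isAdmissible

theorem isPartialOrder_le : IsPartialOrder V Γ.Le where
  refl _ := Relation.ReflTransGen.refl
  trans _ _ _ := Relation.ReflTransGen.trans
  antisymm _ _ h h' := by
    obtain ⟨_, hr⟩ := Γ.exists_isModularOrientation
    exact hr.antisymm h h'

/-- The vertices of a modular complex ordered by reachability. -/
abbrev partialOrder : PartialOrder V where
  le := Γ.Le
  le_refl := Γ.isPartialOrder_le.refl
  le_trans := Γ.isPartialOrder_le.trans
  le_antisymm := Γ.isPartialOrder_le.antisymm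

/-- An element strictly between the ends of an arrow would lie on a geodesic between them, which
adjacency excludes. -/
theorem covBy_iff_arrow {x y : V} : letI := Γ.partialOrder; x ⋖ y ↔ Γ.Arrow x y := by
  let _ := Γ.partialOrder
  obtain ⟨_, hr⟩ := Γ.exists_isModularOrientation
  constructor
  · intro h
    obtain rfl | ⟨z, hxz, hzy⟩ := Relation.ReflTransGen.cases_head (show Γ.Le x y from h.le)
    · exact absurd rfl h.ne
    · rcases h.eq_or_eq (show Γ.Le x z from .single hxz) hzy with rfl | rfl
      · exact absurd rfl (hr.adj hxz).ne
      · exact hxz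
  · intro h
    have hadj := metricGraph_adj_iff.1 (hr.adj h)
    refine ⟨lt_of_le_of_ne (show Γ.Le x y from .single h) hadj.1, fun z hxz hzy => ?_⟩
    rcases hadj.2 z (hr.dist_add_dist hxz.le hzy.le) with rfl | rfl
    · exact lt_irrefl _ hxz
    · exact lt_irrefl _ hzy

theorem isLocallyModular : letI := Γ.partialOrder; IsLocallyModular V := by
  let _ := Γ.partialOrder
  obtain ⟨_, hr⟩ := Γ.exists_isModularOrientation
  constructor
  · intro a b c u hab hac hne hbu hcu
    rw [Γ.covBy_iff_arrow] at hab hac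
    obtain ⟨d, hbd, hcd, hd⟩ := hr.exists_arrow_join hab hac hne hbu hcu
    refine ⟨d, Γ.covBy_iff_arrow.2 hbd, Γ.covBy_iff_arrow.2 hcd, ?_, fun v hv => ?_⟩
    · rintro x (rfl | rfl)
      · exact .single hbd
      · exact .single hcd
    · exact hd v (hv (by simp)) (hv (by simp))
  · intro a b c u hab hac hne hbu hcu
    rw [Γ.covBy_iff_arrow] at hab hac
    obtain ⟨d, hbd, hcd, hd⟩ := hr.swap.exists_arrow_join hab hac hne
      (Relation.reflTransGen_swap.2 hbu) (Relation.reflTransGen_swap.2 hcu)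
    refine ⟨d, Γ.covBy_iff_arrow.2 hbd, Γ.covBy_iff_arrow.2 hcd, ?_, fun v hv => ?_⟩
    · rintro x (rfl | rfl)
      · exact .single hbd
      · exact .single hcd
    · exact Relation.reflTransGen_swap.1 (hd v (Relation.reflTransGen_swap.2 (hv (by simp)))
        (Relation.reflTransGen_swap.2 (hv (by simp))))

theorem isJoin_iff_isLUB {p q j : V} :
    letI := Γ.partialOrder; Γ.IsJoin p q j ↔ IsLUB {p, q} j := by
  let _ := Γ.partialOrder
  rw [isLUB_pair_iff]
  exact ⟨fun h u => ⟨fun hu => ⟨h.1.trans hu, h.2.1.trans hu⟩, fun hu => h.2.2 u hu.1 hu.2⟩,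
    fun h => ⟨((h j).1 le_rfl).1, ((h j).1 le_rfl).2, fun u hp hq => (h u).2 ⟨hp, hq⟩⟩⟩

theorem IsMeet.isGLB {p q m : V} (h : Γ.IsMeet p q m) :
    letI := Γ.partialOrder; IsGLB {p, q} m := by
  let _ := Γ.partialOrder
  refine ⟨?_, fun u hu => h.2.2 u (hu (by simp)) (hu (by simp))⟩
  rintro x (rfl | rfl)
  · exact h.1
  · exact h.2.1

theorem booleanPair_iff {p q : V} :
    letI := Γ.partialOrder; Γ.BooleanPair p q ↔ IsBooleanPair p q := by
  simp only [BooleanPair, IsBooleanPair, Γ.covBy_iff_arrow]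

theorem isAdmissibleRel_le : Γ.IsAdmissibleRel Γ.Le where
  coarsens _ _ h := h
  refl := Γ.isPartialOrder_le.refl
  arrow _ _ h := .single h
  sub _ _ _ _ _ h _ _ := h
  join _ _ _ _ h _ hj := h.trans hj.1
  meet _ _ _ _ h _ hm := hm.1.trans h

theorem isAdmissibleRel_booleanPair [Finite V] : Γ.IsAdmissibleRel Γ.BooleanPair := by
  let _ := Γ.partialOrder
  have := Γ.isLocallyModular
  constructor <;> simp only [Γ.booleanPair_iff, Γ.isJoin_iff_isLUB]
  · exact fun p q h => h.isAtomisticPair.1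
  · exact fun p => IsAtomisticPair.isBooleanPair ⟨le_rfl, fun _ hu _ => hu⟩
  · intro p q h
    rw [← Γ.covBy_iff_arrow] at h
    exact IsAtomisticPair.isBooleanPair ⟨h.le, fun _ _ hu => hu q h le_rfl⟩
  · exact fun p q a b h hab ha hb => h.of_le ha.1 hab hb.2
  · exact fun p q₁ q₂ j h₁ h₂ hj => h₁.of_isLUB h₂ hj
  · exact fun p₁ p₂ q m h₁ h₂ hm => h₁.of_isGLB h₂ hm.isGLB

theorem IsAdmissibleRel.of_booleanPair {Γ : ModularComplex V} {R : V → V → Prop}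
    (hR : Γ.IsAdmissibleRel R) {p q : V} (h : Γ.BooleanPair p q) : R p q := by
  let _ := Γ.partialOrder
  have := Γ.isLocallyModular
  exact (Γ.booleanPair_iff.1 h).induction (hR.refl p)
    (fun a ha => hR.arrow p a (Γ.covBy_iff_arrow.1 ha))
    fun x y j hx hy hj => hR.join p x y j hx hy (Γ.isJoin_iff_isLUB.2 hj)

end ModularComplex

theorem proposition1 {V : Type*} [Finite V] (Γ : ModularComplex V) :
    IsPartialOrder V Γ.Le ∧
    Γ.IsAdmissibleRel Γ.BooleanPair ∧
    Γ.IsAdmissibleRel Γ.Le ∧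
    ∀ R : V → V → Prop, Γ.IsAdmissibleRel R →
      (∀ p q, Γ.BooleanPair p q → R p q) ∧ (∀ p q, R p q → Γ.Le p q) :=
  ⟨Γ.isPartialOrder_le, Γ.isAdmissibleRel_booleanPair, Γ.isAdmissibleRel_le,
    fun _ hR => ⟨fun _ _ => hR.of_booleanPair, hR.coarsens⟩⟩
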